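/- The series $\sum_{n\ge 2}(n\log n)^{-s}$ converges absolutely for every complex $s$ with $\operatorname{Re} s>1$. There is a (necessarily unique) real constant $C_{1,1}$ such that $$\sum_{k=2}^{n-1}\frac{1}{k\log k}=\log\log n+C_{1,1}+o(1)\qquad(n\to\infty),$$ and with this constant $$\sum_{n=2}^{\infty}\frac{1}{(n\log n)^{s}}=-\log(s-1)+C_{1,1}-\gamma+O\big((s-1)\log^2(s-1)\big)$$ as $s\to1$ in the half-plane $\operatorname{Re} s>1$, where $\log$ is the principal logarithm and $\gamma$ is the Euler–Mascheroni constant. -/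

import Mathlib

open Filter Topology Asymptotics

/-- The Dirichlet-type series `∑_{n ≥ 2} (n log n)^{-s}` for complex `s`; the summation index is
shifted by two, and the powers have the positive real base `n log n`. -/
noncomputable def nLogNZeta (s : ℂ) : ℂ :=
  ∑' n : ℕ, ((((n + 2 : ℕ) : ℝ) * Real.log ((n + 2 : ℕ) : ℝ) : ℝ) : ℂ) ^ (-s)

/-- `C` is the constant term in `∑_{2 ≤ k < n} 1 / (k log k) = log log n + C + o(1)`. -/
def IsLogLogConstant (C : ℝ) : Prop :=
  Tendsto (fun n : ℕ => (∑ k ∈ Finset.Ico 2 n, 1 / ((k : ℝ) * Real.log k)) -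
    Real.log (Real.log n)) atTop (𝓝 C)

/-! Put `s = 1 + w`. Subtracting `1 / (k log k)` from each term leaves differences whose sum is
within `O(|w|)` of the corresponding integral, uniformly in the half-plane. The subtracted sums and
integrals contribute `C + log log 2`, and the substitution `t = log x` turns the remaining integral
into `∫_L^∞ t^(-w-1) e^(-wt) dt` with `L = log 2`.

Integration by parts and Euler's integral express `w` times this integral as `L^(-w) e^(-wL) - w^w
Γ(1-w) + w ∫_0^L t^(-w) e^(-wt) dt`. To first order the three terms are `1 - w(L + log L)`, `-(1 + w
log w + γw)` and `wL`. The sum is `-w(log L + log w + γ)` with error `O(w² log² w)`. After division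
by `w`, the term `-log L` cancels `log log 2`. -/

/-! ### Euler's integral with complex scaling -/

open MeasureTheory Set in
theorem integrableOn_cpow_mul_exp_neg_mul {a r : ℂ} (ha : -1 < a.re) (hr : 0 < r.re) :
    IntegrableOn (fun t : ℝ => (t : ℂ) ^ a * Complex.exp (-(r * t))) (Ioi 0) := by
  have h := integrableOn_rpow_mul_exp_neg_mul_rpow (p := 1) ha one_pos hr
  refine Integrable.mono' h ?_ ?_
  · refine ContinuousOn.aestronglyMeasurable (fun t ht => ContinuousAt.continuousWithinAt ?_)
      measurableSet_Ioi
    have h1 : ContinuousAt (fun t : ℝ => (t : ℂ) ^ a) t :=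
      Complex.continuousAt_ofReal_cpow_const _ _ (Or.inr (ne_of_gt ht))
    exact h1.mul (by fun_prop)
  · filter_upwards [ae_restrict_mem measurableSet_Ioi] with t ht
    rw [norm_mul, Complex.norm_cpow_eq_rpow_re_of_pos ht, Complex.norm_exp]
    simp

-- Holomorphy in the scaling parameter is what the identity theorem needs to pass from real to
-- complex `r`. On `Re z > Re r / 2` the derivative has an integrable majorant independent of `z`.
open MeasureTheory Set in
theorem differentiableAt_integral_cpow_mul_exp_neg_mul {a r : ℂ} (ha : -1 < a.re)
    (hr : 0 < r.re) :
    DifferentiableAt ℂ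
      (fun r : ℂ => ∫ t : ℝ in Ioi 0, (t : ℂ) ^ a * Complex.exp (-(r * t))) r := by
  have hs : {z : ℂ | r.re / 2 < z.re} ∈ 𝓝 r :=
    (isOpen_lt continuous_const Complex.continuous_re).mem_nhds (by simp; linarith)
  have hbd := integrableOn_rpow_mul_exp_neg_mul_rpow (p := 1) (s := a.re + 1) (b := r.re / 2)
    (by linarith) one_pos (by linarith)
  refine (hasDerivAt_integral_of_dominated_loc_of_deriv_le
    (F := fun (r : ℂ) (t : ℝ) => (t : ℂ) ^ a * Complex.exp (-(r * t)))
    (F' := fun (r : ℂ) (t : ℝ) => (t : ℂ) ^ a * (Complex.exp (-(r * t)) * -t)) hs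
    ?_ (integrableOn_cpow_mul_exp_neg_mul ha hr) ?_ ?_ hbd ?_).2.differentiableAt
  · filter_upwards [hs] with z hz
    have hz' : r.re / 2 < z.re := hz
    exact (integrableOn_cpow_mul_exp_neg_mul ha (by linarith)).aestronglyMeasurable
  · have h := (integrableOn_cpow_mul_exp_neg_mul ha hr).aestronglyMeasurable.mul
      (Complex.continuous_ofReal.neg.aestronglyMeasurable (μ := volume.restrict (Ioi 0)))
    refine h.congr (Eventually.of_forall fun t => ?_)
    simp [mul_assoc]
  · filter_upwards [ae_restrict_mem measurableSet_Ioi] with t ht z hz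
    have ht' : 0 < t := ht
    have hz' : r.re / 2 < z.re := hz
    rw [norm_mul, norm_mul, Complex.norm_cpow_eq_rpow_re_of_pos ht, Complex.norm_exp,
      Real.rpow_add_one ht'.ne', Real.rpow_one, norm_neg, Complex.norm_real,
      Real.norm_of_nonneg ht'.le, mul_assoc, mul_comm t]
    gcongr
    simp
    nlinarith
  · filter_upwards with t z _
    have h : HasDerivAt (fun z : ℂ => -(z * t)) (-t) z := by
      simpa using ((hasDerivAt_id z).mul_const (t : ℂ)).fun_neg
    exact h.cexp.const_mul _

open MeasureTheory Set in
/-- Euler's integral with a complex scaling parameter in the right half-plane. -/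
theorem integral_cpow_mul_exp_neg_mul_Ioi_of_re_pos {a r : ℂ} (ha : 0 < a.re) (hr : 0 < r.re) :
    ∫ t : ℝ in Ioi 0, (t : ℂ) ^ (a - 1) * Complex.exp (-(r * t)) =
      r ^ (-a) * Complex.Gamma a := by
  have hopen : IsOpen {z : ℂ | 0 < z.re} := isOpen_lt continuous_const Complex.continuous_re
  have hf : AnalyticOnNhd ℂ
      (fun r : ℂ => ∫ t : ℝ in Ioi 0, (t : ℂ) ^ (a - 1) * Complex.exp (-(r * t)))
      {z : ℂ | 0 < z.re} :=
    DifferentiableOn.analyticOnNhd (fun z hz =>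
      (differentiableAt_integral_cpow_mul_exp_neg_mul (by simpa using ha)
        hz).differentiableWithinAt) hopen
  have hg : AnalyticOnNhd ℂ (fun r : ℂ => r ^ (-a) * Complex.Gamma a) {z : ℂ | 0 < z.re} :=
    DifferentiableOn.analyticOnNhd (fun z hz =>
      (((differentiableAt_id).cpow_const (Or.inl hz)).mul_const _).differentiableWithinAt) hopen
  refine hf.eqOn_of_preconnected_of_frequently_eq hg
    (convex_halfSpace_re_gt 0).isPreconnected (z₀ := 1) (by simp) ?_ hr
  -- The formula is known for real `r > 0`; these real points accumulate at `1` without reaching it.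
  have hu : Tendsto (fun n : ℕ => ((1 + 1 / ((n : ℝ) + 1) : ℝ) : ℂ)) atTop (𝓝[≠] 1) := by
    rw [tendsto_nhdsWithin_iff]
    constructor
    · have := (tendsto_one_div_add_atTop_nhds_zero_nat (𝕜 := ℝ)).const_add 1
      rw [add_zero] at this
      exact_mod_cast (Complex.continuous_ofReal.tendsto _).comp this
    · refine Eventually.of_forall fun n => ?_
      have : (0 : ℝ) < 1 / ((n : ℝ) + 1) := by positivity
      simp only [mem_compl_iff, mem_singleton_iff]
      intro h
      have h' : (1 + 1 / ((n : ℝ) + 1) : ℝ) = 1 := by exact_mod_cast h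
      linarith
  refine hu.frequently (Frequently.of_forall fun n => ?_)
  have hpos : (0 : ℝ) < 1 + 1 / ((n : ℝ) + 1) := by positivity
  rw [Complex.integral_cpow_mul_exp_neg_mul_Ioi ha hpos, one_div, Complex.inv_cpow,
    Complex.cpow_neg]
  rw [Complex.arg_ofReal_of_nonneg hpos.le]
  exact Real.pi_pos.ne

/-! ### The tail integral by parts -/

open MeasureTheory Set in
theorem integrableOn_cpow_sub_one_mul_exp_neg_mul {w : ℂ} {L : ℝ} (hL : 0 < L)
    (h0 : 0 < w.re) :
    IntegrableOn (fun t : ℝ => (t : ℂ) ^ (-w - 1) * Complex.exp (-(w * t))) (Ioi L) := by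
  refine Integrable.mono' (integrableOn_Ioi_rpow_of_lt (a := -w.re - 1) (by linarith) hL) ?_ ?_
  · refine ContinuousOn.aestronglyMeasurable (fun t ht => ContinuousAt.continuousWithinAt ?_)
      measurableSet_Ioi
    have h1 : ContinuousAt (fun t : ℝ => (t : ℂ) ^ (-w - 1)) t :=
      Complex.continuousAt_ofReal_cpow_const _ _ (Or.inr (ne_of_gt (hL.trans ht)))
    exact h1.mul (by fun_prop)
  · filter_upwards [ae_restrict_mem measurableSet_Ioi] with t ht
    have ht' : 0 < t := hL.trans ht
    rw [norm_mul, Complex.norm_cpow_eq_rpow_re_of_pos ht', Complex.norm_exp]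
    refine (mul_le_of_le_one_right (by positivity) ?_).trans_eq (by simp)
    rw [Real.exp_le_one_iff]
    simp
    positivity

open MeasureTheory Set in
theorem tendsto_cpow_mul_exp_neg_mul_atTop {w : ℂ} (h0 : 0 < w.re) :
    Tendsto (fun t : ℝ => (t : ℂ) ^ (-w) * Complex.exp (-(w * t))) atTop (𝓝 0) := by
  refine squeeze_zero_norm' ?_ (tendsto_rpow_neg_atTop h0)
  filter_upwards [eventually_gt_atTop 0] with t ht
  rw [norm_mul, Complex.norm_cpow_eq_rpow_re_of_pos ht, Complex.norm_exp]
  refine (mul_le_of_le_one_right (by positivity) ?_).trans_eq (by simp)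
  rw [Real.exp_le_one_iff]
  simp
  positivity

open MeasureTheory Set in
/-- Integration by parts, combined with Euler's integral. -/
theorem mul_integral_cpow_sub_one_mul_exp_neg_mul {w : ℂ} {L : ℝ} (hL : 0 < L)
    (h0 : 0 < w.re) (h1 : w.re < 1) :
    w * ∫ t : ℝ in Ioi L, (t : ℂ) ^ (-w - 1) * Complex.exp (-(w * t)) =
      (L : ℂ) ^ (-w) * Complex.exp (-(w * L)) - w ^ w * Complex.Gamma (1 - w) +
        w * ∫ t : ℝ in 0..L, (t : ℂ) ^ (-w) * Complex.exp (-(w * t)) := by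
  have hw : w ≠ 0 := fun h => by simp [h] at h0
  have hA := integrableOn_cpow_sub_one_mul_exp_neg_mul hL h0
  have hB0 := integrableOn_cpow_mul_exp_neg_mul (a := -w) (r := w) (by simp; linarith) h0
  have hB : IntegrableOn (fun t : ℝ => (t : ℂ) ^ (-w) * Complex.exp (-(w * t))) (Ioi L) :=
    hB0.mono_set (Ioi_subset_Ioi hL.le)
  have hderiv : ∀ t : ℝ, 0 < t →
      HasDerivAt (fun t : ℝ => (t : ℂ) ^ (-w) * Complex.exp (-(w * t)))
        (-w * ((t : ℂ) ^ (-w - 1) * Complex.exp (-(w * t))) +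
          -w * ((t : ℂ) ^ (-w) * Complex.exp (-(w * t)))) t := by
    intro t ht
    have e1 := hasDerivAt_ofReal_cpow_const ht.ne' (neg_ne_zero.mpr hw)
    have e2 : HasDerivAt (fun t : ℝ => -(w * (t : ℂ))) (-w) t := by
      simpa using ((hasDerivAt_id t).ofReal_comp.const_mul w).fun_neg
    exact (e1.fun_mul e2.cexp).congr_deriv (by ring)
  have hparts := integral_Ioi_of_hasDerivAt_of_tendsto
    (hderiv L hL).continuousAt.continuousWithinAt (fun t ht => hderiv t (hL.trans ht))
    ((hA.const_mul _).add (hB.const_mul _)) (tendsto_cpow_mul_exp_neg_mul_atTop h0)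
  rw [integral_add (hA.const_mul _) (hB.const_mul _), integral_const_mul,
    integral_const_mul] at hparts
  have hsplit := intervalIntegral.integral_interval_add_Ioi hB0 hB
  have hG := integral_cpow_mul_exp_neg_mul_Ioi_of_re_pos (a := 1 - w) (r := w)
    (by simpa using h1) h0
  rw [show (1 : ℂ) - w - 1 = -w by ring, show -(1 - w) = w - 1 by ring] at hG
  have hpow : w ^ w = w * w ^ (w - 1) := by
    rw [Complex.cpow_sub _ _ hw, Complex.cpow_one]
    field_simp
  rw [hpow]
  rw [hG] at hsplit
  linear_combination -hparts - w * hsplit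

/-! ### Expansions at the origin -/

theorem tendsto_mul_log_nhds_zero : Tendsto (fun w : ℂ => w * Complex.log w) (𝓝 0) (𝓝 0) := by
  have h1 : Tendsto (fun w : ℂ => |‖w‖ * Real.log ‖w‖| + Real.pi * ‖w‖) (𝓝 0) (𝓝 0) := by
    have hc : Continuous (fun w : ℂ => |‖w‖ * Real.log ‖w‖| + Real.pi * ‖w‖) :=
      (Real.continuous_mul_log.comp continuous_norm).abs.add (by fun_prop)
    simpa using hc.tendsto 0
  refine squeeze_zero_norm (fun w => ?_) h1
  have h2 : ‖Complex.log w‖ ≤ |Real.log ‖w‖| + Real.pi := by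
    refine (Complex.norm_le_abs_re_add_abs_im _).trans ?_
    rw [Complex.log_re, Complex.log_im]
    gcongr
    exact Complex.abs_arg_le_pi w
  rw [norm_mul, abs_mul, abs_of_nonneg (norm_nonneg w)]
  nlinarith [norm_nonneg w]

/-- Since `|log w| ≥ |log ‖w‖| → ∞`, errors without logarithms are absorbed into those with them. -/
theorem one_isBigO_clog : (fun _ : ℂ => (1 : ℂ)) =O[𝓝[≠] 0] Complex.log := by
  have h : Tendsto (fun w : ℂ => Real.log ‖w‖) (𝓝[≠] 0) atBot :=
    Real.tendsto_log_nhdsGT_zero.comp tendsto_norm_nhdsNE_zero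
  refine IsBigO.of_bound 1 ?_
  filter_upwards [h.eventually_le_atBot (-1)] with w hw
  have := Complex.abs_re_le_norm (Complex.log w)
  rw [Complex.log_re, abs_of_nonpos (by linarith)] at this
  simp
  linarith

theorem exp_sub_one_sub_id_isBigO :
    (fun z : ℂ => Complex.exp z - 1 - z) =O[𝓝 0] (fun z => z ^ 2) := by
  refine IsBigO.of_bound 1 ?_
  filter_upwards [Metric.closedBall_mem_nhds (0 : ℂ) one_pos] with z hz
  rw [norm_pow, one_mul]
  exact Complex.norm_exp_sub_one_sub_id_le (by simpa using hz)

/-- The constant `γ` enters here, through `Γ'(1) = -γ`. -/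
theorem Gamma_one_sub_isBigO :
    (fun w : ℂ => Complex.Gamma (1 - w) - 1 - Real.eulerMascheroniConstant * w)
      =O[𝓝 0] (fun w => w ^ 2) := by
  have han : AnalyticAt ℂ Complex.Gamma 1 := by
    rw [Complex.analyticAt_iff_eventually_differentiableAt]
    filter_upwards [(isOpen_lt continuous_const Complex.continuous_re).mem_nhds
      (show (0 : ℝ) < (1 : ℂ).re by simp)] with z hz
    refine Complex.differentiableAt_Gamma z fun m h => ?_
    have hz' : 0 < z.re := hz
    rw [h] at hz'
    simp at hz'
    linarith [m.cast_nonneg (α := ℝ)]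
  obtain ⟨p, hp⟩ := han
  have h := hp.isBigO_sub_partialSum_pow 2
  have hc : ∀ y : ℂ, p.partialSum 2 y = 1 - Real.eulerMascheroniConstant * y := by
    intro y
    have h1 : p.coeff 1 = -Real.eulerMascheroniConstant :=
      hp.hasDerivAt.unique Complex.hasDerivAt_Gamma_one
    have h0 : p.coeff 0 = 1 := by
      rw [FormalMultilinearSeries.coeff, hp.coeff_zero, Complex.Gamma_one]
    simp [FormalMultilinearSeries.partialSum, Finset.sum_range_succ, h0, h1]
    ring
  have hneg : Tendsto (fun w : ℂ => -w) (𝓝 0) (𝓝 0) := by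
    simpa using (continuous_neg (G := ℂ)).tendsto 0
  refine ((h.comp_tendsto hneg).trans (IsBigO.of_bound 1 ?_)).congr_left fun w => ?_
  · exact Eventually.of_forall fun w => by simp
  · simp [hc]
    ring_nf

theorem cpow_self_mul_Gamma_isBigO :
    (fun w : ℂ => w ^ w * Complex.Gamma (1 - w) - 1 - w * Complex.log w
        - Real.eulerMascheroniConstant * w)
      =O[𝓝[≠] 0] (fun w => w ^ 2 * Complex.log w ^ 2) := by
  have hlog := one_isBigO_clog
  have hG := Gamma_one_sub_isBigO.mono (nhdsWithin_le_nhds (s := {(0 : ℂ)}ᶜ))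
  have hR := exp_sub_one_sub_id_isBigO.comp_tendsto
    (tendsto_mul_log_nhds_zero.mono_left (nhdsWithin_le_nhds (s := {(0 : ℂ)}ᶜ)))
  have hw2 : (fun w : ℂ => w ^ 2) =O[𝓝[≠] 0] (fun w => w ^ 2 * Complex.log w ^ 2) := by
    simpa using (isBigO_refl (fun w : ℂ => w ^ 2) _).mul (hlog.pow 2)
  have hGc : (fun w : ℂ => Complex.Gamma (1 - w)) =O[𝓝[≠] 0] (fun _ => (1 : ℂ)) := by
    have : ContinuousAt (fun w : ℂ => Complex.Gamma (1 - w)) 0 := by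
      refine ContinuousAt.comp' ?_ (by fun_prop)
      rw [sub_zero]
      exact Complex.hasDerivAt_Gamma_one.continuousAt
    exact (this.tendsto.mono_left nhdsWithin_le_nhds).isBigO_one ℂ
  have hG1 : (fun w : ℂ => Complex.Gamma (1 - w) - 1) =O[𝓝[≠] 0] (fun w => w) := by
    have hd : HasDerivAt (fun w : ℂ => Complex.Gamma (1 - w)) (Real.eulerMascheroniConstant) 0 := by
      have h1 : HasDerivAt Complex.Gamma (-Real.eulerMascheroniConstant : ℂ) (1 - 0) := by
        simpa using Complex.hasDerivAt_Gamma_one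
      simpa using h1.comp_const_sub 1 0
    simpa using hd.isBigO_sub.mono (nhdsWithin_le_nhds (s := {(0 : ℂ)}ᶜ))
  -- With `z = w log w`, the remainder splits as `(e^z - 1 - z) Γ + z (Γ - 1) + (Γ - 1 - γw)`, where
  -- `Γ` is taken at `1 - w`.
  have t1 : (fun w : ℂ => (Complex.exp (w * Complex.log w) - 1 - w * Complex.log w) *
      Complex.Gamma (1 - w)) =O[𝓝[≠] 0] (fun w => w ^ 2 * Complex.log w ^ 2) := by
    refine (hR.mul hGc).congr_right fun w => ?_
    simp [mul_pow]
  have t2 : (fun w : ℂ => w * Complex.log w * (Complex.Gamma (1 - w) - 1)) =O[𝓝[≠] 0]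
      (fun w => w ^ 2 * Complex.log w ^ 2) := by
    have := ((isBigO_refl (fun w : ℂ => w * Complex.log w) _).mul hG1).mul hlog
    exact this.congr (fun w => by ring) (fun w => by ring)
  refine ((t1.add t2).add (hG.trans hw2)).congr' ?_ EventuallyEq.rfl
  filter_upwards [self_mem_nhdsWithin] with w hw
  rw [Complex.cpow_def_of_ne_zero hw, mul_comm (Complex.log w) w]
  ring

open MeasureTheory in
theorem integral_cpow_mul_exp_sub_isBigO {L : ℝ} (hL : 0 < L) :
    (fun w : ℂ => (∫ t : ℝ in 0..L, (t : ℂ) ^ (-w) * Complex.exp (-(w * t))) - L)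
      =O[𝓝 0] (fun w => w) := by
  have hsmall : ∀ᶠ w : ℂ in 𝓝 0, ‖w‖ * (L + 1) < 1 / 2 := by
    have : Tendsto (fun w : ℂ => ‖w‖ * (L + 1)) (𝓝 0) (𝓝 0) := by
      have hc : Continuous (fun w : ℂ => ‖w‖ * (L + 1)) := by fun_prop
      simpa using hc.tendsto 0
    exact this.eventually (gt_mem_nhds (by norm_num))
  have hmain : (fun w : ℂ => (L : ℂ) ^ (-w + 1) / (-w + 1) - L) =O[𝓝 0] (fun w => w) := by
    have hd : DifferentiableAt ℂ (fun w : ℂ => (L : ℂ) ^ (-w + 1) / (-w + 1)) 0 := by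
      refine DifferentiableAt.div (DifferentiableAt.const_cpow (by fun_prop) ?_) (by fun_prop) ?_
      · exact Or.inl (by exact_mod_cast hL.ne')
      · simp
    simpa using hd.isBigO_sub
  have herr : (fun w : ℂ => (∫ t : ℝ in 0..L, (t : ℂ) ^ (-w) * Complex.exp (-(w * t))) -
      (L : ℂ) ^ (-w + 1) / (-w + 1)) =O[𝓝 0] (fun w => w) := by
    -- For `|Re w| < 1/2`, `t^(-Re w)` is at most `t^(-1/2)` when `t ≤ 1` and at most `L` when `1 ≤
    -- t ≤ L`. The factor `2L` comes from `|e^z - 1| ≤ 2|z|` for `|z| ≤ 1`.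
    refine IsBigO.of_bound (∫ t : ℝ in 0..L, (1 + L) * (1 + t ^ (-(1 / 2 : ℝ))) * (2 * L)) ?_
    filter_upwards [hsmall] with w hw
    have hw1 : ‖w‖ < 1 / 2 := by nlinarith [norm_nonneg w]
    have hre : |w.re| < 1 / 2 := (Complex.abs_re_le_norm w).trans_lt hw1
    rw [abs_lt] at hre
    have hr : -1 < (-w).re := by simp; linarith
    have hint : IntervalIntegrable (fun t : ℝ => (t : ℂ) ^ (-w)) volume 0 L :=
      intervalIntegral.intervalIntegrable_cpow' hr
    have hint2 : IntervalIntegrable (fun t : ℝ => (t : ℂ) ^ (-w) * Complex.exp (-(w * t)))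
        volume 0 L := hint.mul_continuousOn (by fun_prop)
    have hz : (0 : ℂ) ^ (-w + 1) = 0 := by
      apply Complex.zero_cpow
      intro h
      have := congrArg Complex.re h
      simp at this
      linarith
    have hv : ∫ t : ℝ in 0..L, (t : ℂ) ^ (-w) = (L : ℂ) ^ (-w + 1) / (-w + 1) := by
      rw [integral_cpow (Or.inl hr), Complex.ofReal_zero, hz, sub_zero]
    rw [← hv, ← intervalIntegral.integral_sub hint2 hint, mul_comm,
      ← intervalIntegral.integral_const_mul]
    refine intervalIntegral.norm_integral_le_of_norm_le hL.le ?_ ?_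
    · refine Eventually.of_forall fun t ht => ?_
      have ht0 : 0 < t := ht.1
      rw [show (t : ℂ) ^ (-w) * Complex.exp (-(w * t)) - (t : ℂ) ^ (-w) =
        (t : ℂ) ^ (-w) * (Complex.exp (-(w * t)) - 1) by ring, norm_mul,
        Complex.norm_cpow_eq_rpow_re_of_pos ht0]
      have hn : ‖-(w * (t : ℂ))‖ ≤ ‖w‖ * L := by
        rw [norm_neg, norm_mul, Complex.norm_real, Real.norm_of_nonneg ht0.le]
        exact mul_le_mul_of_nonneg_left ht.2 (norm_nonneg w)
      have he := Complex.norm_exp_sub_one_le (x := -(w * (t : ℂ)))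
        (hn.trans (by nlinarith [norm_nonneg w]))
      have hp : t ^ (-w).re ≤ (1 + L) * (1 + t ^ (-(1 / 2 : ℝ))) := by
        have hp0 : 0 ≤ t ^ (-(1 / 2 : ℝ)) := by positivity
        rcases le_total t 1 with h | h
        · have := Real.rpow_le_rpow_of_exponent_ge ht0 h
            (show -(1 / 2 : ℝ) ≤ (-w).re by simp; linarith)
          nlinarith
        · have h1 := Real.rpow_le_rpow_of_exponent_le h
            (show (-w).re ≤ (1 : ℝ) by simp; linarith)
          rw [Real.rpow_one] at h1
          nlinarith [ht.2]
      calc t ^ (-w).re * ‖Complex.exp (-(w * t)) - 1‖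
          ≤ (1 + L) * (1 + t ^ (-(1 / 2 : ℝ))) * (2 * (‖w‖ * L)) := by
            gcongr
            exact he.trans (by linarith)
        _ = ‖w‖ * ((1 + L) * (1 + t ^ (-(1 / 2 : ℝ))) * (2 * L)) := by ring
    · have hi : IntervalIntegrable (fun t : ℝ => t ^ (-(1 / 2 : ℝ))) volume 0 L :=
        intervalIntegral.intervalIntegrable_rpow' (by norm_num)
      exact (((intervalIntegrable_const.add hi).const_mul _).mul_const _).const_mul _
  exact (herr.add hmain).congr_left fun w => by ring

open MeasureTheory Set in
theorem integral_cpow_sub_one_mul_exp_neg_mul_isBigO {L : ℝ} (hL : 0 < L) :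
    (fun w : ℂ => (∫ t : ℝ in Ioi L, (t : ℂ) ^ (-w - 1) * Complex.exp (-(w * t))) +
        Real.log L + Complex.log w + Real.eulerMascheroniConstant)
      =O[𝓝[{w : ℂ | 0 < w.re}] 0] (fun w => w * Complex.log w ^ 2) := by
  have hne : 𝓝[{w : ℂ | 0 < w.re}] (0 : ℂ) ≤ 𝓝[≠] 0 :=
    nhdsWithin_mono _ fun w hw h => by
      rw [mem_singleton_iff.mp h] at hw
      simp at hw
  have hw2 : (fun w : ℂ => w ^ 2) =O[𝓝[≠] 0] (fun w => w ^ 2 * Complex.log w ^ 2) := by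
    simpa using (isBigO_refl (fun w : ℂ => w ^ 2) _).mul (one_isBigO_clog.pow 2)
  have h1 : (fun w : ℂ => Complex.exp (-(w * (L + Real.log L : ℝ))) - 1
      - -(w * (L + Real.log L : ℝ))) =O[𝓝[≠] 0] (fun w => w ^ 2 * Complex.log w ^ 2) := by
    have ht : Tendsto (fun w : ℂ => -(w * (L + Real.log L : ℝ))) (𝓝 0) (𝓝 0) := by
      have hc : Continuous (fun w : ℂ => -(w * (L + Real.log L : ℝ))) := by fun_prop
      simpa using hc.tendsto 0
    refine (((exp_sub_one_sub_id_isBigO.comp_tendsto ht).trans (IsBigO.of_bound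
      (‖((L + Real.log L : ℝ) : ℂ)‖ ^ 2) (Eventually.of_forall fun w => ?_))).mono
      nhdsWithin_le_nhds).trans hw2
    simp only [Function.comp_apply, neg_sq, norm_pow, norm_mul]
    exact le_of_eq (by ring)
  have h2 := cpow_self_mul_Gamma_isBigO
  have h3 : (fun w : ℂ => w *
      ((∫ t : ℝ in 0..L, (t : ℂ) ^ (-w) * Complex.exp (-(w * t))) - L))
      =O[𝓝[≠] 0] (fun w => w ^ 2 * Complex.log w ^ 2) := by
    refine IsBigO.trans ?_ hw2
    exact ((isBigO_refl (fun w : ℂ => w) _).mul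
      ((integral_cpow_mul_exp_sub_isBigO hL).mono nhdsWithin_le_nhds)).congr_right
      fun w => by ring
  have h4 := (isBigO_refl (fun w : ℂ => w⁻¹) _).mul (((h1.sub h2).add h3).mono hne)
  have hre : ∀ᶠ w : ℂ in 𝓝[{w : ℂ | 0 < w.re}] 0, w.re < 1 :=
    nhdsWithin_le_nhds ((isOpen_lt Complex.continuous_re continuous_const).mem_nhds (by simp))
  refine h4.congr' ?_ ?_
  · filter_upwards [self_mem_nhdsWithin, hre] with w hw hw1
    have hw0 : w ≠ 0 := fun h => by simp [h] at hw
    have key := mul_integral_cpow_sub_one_mul_exp_neg_mul hL hw hw1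
    have hexp : Complex.exp (-(w * (L + Real.log L : ℝ))) =
        (L : ℂ) ^ (-w) * Complex.exp (-(w * L)) := by
      rw [Complex.cpow_def_of_ne_zero (by exact_mod_cast hL.ne'), ← Complex.exp_add,
        ← Complex.ofReal_log hL.le]
      push_cast
      ring_nf
    rw [inv_mul_eq_iff_eq_mul₀ hw0, hexp]
    push_cast
    linear_combination -key
  · filter_upwards [self_mem_nhdsWithin] with w hw
    have hw0 : w ≠ 0 := fun h => by simp [h] at hw
    field_simp

/-! ### Comparison of sum and integral -/

/-- Mean value inequality on `Re z ≤ 0`, where `|exp| ≤ 1`. No smallness of `z` is required, which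
makes the comparison uniform in `x`. -/
theorem norm_exp_neg_sub_one_le {z : ℂ} (hz : 0 ≤ z.re) : ‖Complex.exp (-z) - 1‖ ≤ ‖z‖ := by
  have h := (convex_halfSpace_re_le 0).norm_image_sub_le_of_norm_hasDerivWithin_le
    (f := Complex.exp) (f' := Complex.exp) (C := 1) (x := 0) (y := -z)
    (fun x _ => (Complex.hasDerivAt_exp x).hasDerivWithinAt)
    (fun x hx => by
      rw [Complex.norm_exp, Real.exp_le_one_iff]
      exact hx) (by simp) (by simpa using hz)
  simpa using h

/-- The logarithm of `x log x`. -/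
noncomputable def logMulLog (x : ℝ) : ℝ := Real.log x + Real.log (Real.log x)

theorem exp_logMulLog {x : ℝ} (hx : 1 < x) : Real.exp (logMulLog x) = x * Real.log x := by
  rw [logMulLog, Real.exp_add, Real.exp_log (by linarith), Real.exp_log (Real.log_pos hx)]

theorem logMulLog_nonneg {x : ℝ} (hx : 2 ≤ x) : 0 ≤ logMulLog x := by
  rw [← Real.one_le_exp_iff, exp_logMulLog (by linarith)]
  have h1 := Real.log_two_gt_d9
  have h2 := Real.log_le_log two_pos hx
  nlinarith

theorem hasDerivAt_logMulLog {x : ℝ} (hx : 1 < x) :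
    HasDerivAt logMulLog (x⁻¹ + x⁻¹ / Real.log x) x := by
  have h := Real.hasDerivAt_log (show x ≠ 0 by linarith)
  exact h.add (h.log (Real.log_pos hx).ne')

theorem ofReal_mul_log_cpow_neg {x : ℝ} (hx : 1 < x) (s : ℂ) :
    ((x * Real.log x : ℝ) : ℂ) ^ (-s) = Complex.exp (-s * logMulLog x) := by
  have h : (0 : ℝ) < x * Real.log x := mul_pos (by linarith) (Real.log_pos hx)
  rw [Complex.cpow_def_of_ne_zero (by exact_mod_cast h.ne'), ← Complex.ofReal_log h.le,
    Real.log_mul (by linarith) (Real.log_pos hx).ne', mul_comm]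
  rfl

/-- The difference `(x log x)^{-(1 + w)} - (x log x)^{-1}`. -/
noncomputable def mulLogPowDiff (w : ℂ) (x : ℝ) : ℂ :=
  Complex.exp (-(1 + w) * logMulLog x) - Complex.exp (-logMulLog x)

/-- A decreasing function whose decrements dominate those of `mulLogPowDiff`. -/
noncomputable def mulLogMajorant (x : ℝ) : ℝ :=
  Real.exp (-logMulLog x) * (logMulLog x + 2)

theorem hasDerivAt_mulLogPowDiff (w : ℂ) {x : ℝ} (hx : 1 < x) :
    HasDerivAt (mulLogPowDiff w)
      (((x⁻¹ + x⁻¹ / Real.log x : ℝ) : ℂ) * Complex.exp (-logMulLog x) *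
        (-(Complex.exp (-(w * logMulLog x)) - 1) - w * Complex.exp (-(w * logMulLog x)))) x := by
  have h := (hasDerivAt_logMulLog hx).ofReal_comp
  have h1 := (h.const_mul (-(1 + w))).cexp
  have h2 := h.fun_neg.cexp
  refine (h1.fun_sub h2).congr_deriv ?_
  rw [show -(1 + w) * (logMulLog x : ℂ) = -logMulLog x + -(w * logMulLog x) by ring,
    Complex.exp_add]
  ring

theorem hasDerivAt_mulLogMajorant {x : ℝ} (hx : 1 < x) :
    HasDerivAt mulLogMajorant
      (-((x⁻¹ + x⁻¹ / Real.log x) * Real.exp (-logMulLog x) * (logMulLog x + 1))) x := by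
  have h := hasDerivAt_logMulLog hx
  exact (h.fun_neg.exp.fun_mul (h.add_const 2)).congr_deriv (by ring)

/-- With `φ = logMulLog`, the derivative of the difference is at most `|w| φ' e^(-φ) (φ + 1)` in
norm. This is exactly `-|w|` times the derivative of `e^(-φ) (φ + 2)`. -/
theorem norm_mulLogPowDiff_sub_le {w : ℂ} (hw : 0 ≤ w.re) {a x : ℝ} (ha : 2 ≤ a) (hx : a ≤ x) :
    ‖mulLogPowDiff w x - mulLogPowDiff w a‖ ≤ ‖w‖ * (mulLogMajorant a - mulLogMajorant x) := by
  have hf : ∀ y ∈ Set.Icc a x, HasDerivAt (fun y => mulLogPowDiff w y - mulLogPowDiff w a) _ y :=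
    fun y hy => (hasDerivAt_mulLogPowDiff w (by linarith [hy.1])).sub_const _
  have hB : ∀ y ∈ Set.Icc a x,
      HasDerivAt (fun y => ‖w‖ * (mulLogMajorant a - mulLogMajorant y)) _ y :=
    fun y hy => ((hasDerivAt_mulLogMajorant (by linarith [hy.1])).const_sub _).const_mul _
  refine image_norm_le_of_norm_deriv_right_le_deriv_boundary'
    (f := fun y => mulLogPowDiff w y - mulLogPowDiff w a)
    (B := fun y => ‖w‖ * (mulLogMajorant a - mulLogMajorant y))
    (fun y hy => (hf y hy).continuousAt.continuousWithinAt)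
    (fun y hy => (hf y (Set.Ico_subset_Icc_self hy)).hasDerivWithinAt) (by simp)
    (fun y hy => (hB y hy).continuousAt.continuousWithinAt)
    (fun y hy => (hB y (Set.Ico_subset_Icc_self hy)).hasDerivWithinAt) ?_
    (Set.right_mem_Icc.mpr hx)
  intro y hy
  have hy2 : 2 ≤ y := ha.trans hy.1
  have hφ := logMulLog_nonneg hy2
  have hlog := Real.log_pos (show 1 < y by linarith)
  have hre : 0 ≤ (w * logMulLog y).re := by
    simp
    positivity
  have h1 := norm_exp_neg_sub_one_le hre
  rw [norm_mul, Complex.norm_real, Real.norm_of_nonneg hφ] at h1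
  have h2 : ‖Complex.exp (-(w * logMulLog y))‖ ≤ 1 := by
    rw [Complex.norm_exp, Real.exp_le_one_iff, Complex.neg_re]
    linarith
  have h3 : ‖-(Complex.exp (-(w * logMulLog y)) - 1) - w * Complex.exp (-(w * logMulLog y))‖ ≤
      ‖w‖ * (logMulLog y + 1) := by
    refine (norm_sub_le _ _).trans ?_
    rw [norm_neg, norm_mul]
    nlinarith [norm_nonneg w]
  rw [norm_mul, norm_mul, Complex.norm_real, Real.norm_of_nonneg (by positivity),
    ← Complex.ofReal_neg, ← Complex.ofReal_exp, Complex.norm_real,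
    Real.norm_of_nonneg (Real.exp_nonneg _)]
  calc _ ≤ (y⁻¹ + y⁻¹ / Real.log y) * Real.exp (-logMulLog y) * (‖w‖ * (logMulLog y + 1)) := by
        gcongr
    _ = _ := by ring

theorem continuousOn_mulLogPowDiff (w : ℂ) : ContinuousOn (mulLogPowDiff w) (Set.Ioi 1) :=
  fun _ hx => (hasDerivAt_mulLogPowDiff w hx).continuousAt.continuousWithinAt

theorem intervalIntegrable_mulLogPowDiff (w : ℂ) {a b : ℝ} (ha : 2 ≤ a) (hb : 2 ≤ b) :
    IntervalIntegrable (mulLogPowDiff w) MeasureTheory.volume a b := by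
  refine ((continuousOn_mulLogPowDiff w).mono fun x hx => ?_).intervalIntegrable
  have := hx.1
  have h2 : (2 : ℝ) ≤ min a b := le_min ha hb
  exact lt_of_lt_of_le (by norm_num) (h2.trans this)

theorem norm_mulLogPowDiff_sub_integral_le {w : ℂ} (hw : 0 ≤ w.re) {a : ℝ} (ha : 2 ≤ a) :
    ‖mulLogPowDiff w a - ∫ x in a..a + 1, mulLogPowDiff w x‖ ≤
      ‖w‖ * (mulLogMajorant a - mulLogMajorant (a + 1)) := by
  have hc : mulLogPowDiff w a = ∫ _ in a..a + 1, mulLogPowDiff w a := by simp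
  have hi := intervalIntegrable_mulLogPowDiff w ha (show 2 ≤ a + 1 by linarith)
  nth_rewrite 1 [hc]
  rw [← intervalIntegral.integral_sub intervalIntegrable_const hi]
  refine (intervalIntegral.norm_integral_le_of_norm_le_const
    (C := ‖w‖ * (mulLogMajorant a - mulLogMajorant (a + 1))) fun x hx => ?_).trans (by simp)
  rw [Set.uIoc_of_le (by linarith)] at hx
  rw [norm_sub_rev]
  have h1 := norm_mulLogPowDiff_sub_le hw ha hx.1.le
  -- Nonnegativity of the norm yields the monotonicity of `‖w‖ * mulLogMajorant` on `[x, a + 1]`.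
  have h2 := (norm_nonneg _).trans
    (norm_mulLogPowDiff_sub_le hw (show 2 ≤ x by linarith [hx.1]) hx.2)
  linarith

/-- The unit-interval bounds telescope, so the error stays bounded as `n` grows. -/
theorem norm_sum_mulLogPowDiff_sub_integral_le {w : ℂ} (hw : 0 ≤ w.re) {n : ℕ} (hn : 2 ≤ n) :
    ‖∑ k ∈ Finset.Ico 2 n, mulLogPowDiff w k - ∫ x in (2 : ℝ)..n, mulLogPowDiff w x‖ ≤
      ‖w‖ * (mulLogMajorant 2 - mulLogMajorant n) := by
  induction n, hn using Nat.le_induction with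
  | base => simp
  | succ n hn ih =>
    have hn' : (2 : ℝ) ≤ n := by exact_mod_cast hn
    have h := norm_mulLogPowDiff_sub_integral_le hw hn'
    rw [Finset.sum_Ico_succ_top hn]
    push_cast
    rw [← intervalIntegral.integral_add_adjacent_intervals
      (intervalIntegrable_mulLogPowDiff w le_rfl hn')
      (intervalIntegrable_mulLogPowDiff w hn' (show (2 : ℝ) ≤ n + 1 by linarith)),
      add_sub_add_comm]
    refine (norm_add_le _ _).trans ?_
    linarith

theorem mulLogMajorant_nonneg {x : ℝ} (hx : 2 ≤ x) : 0 ≤ mulLogMajorant x := by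
  have := logMulLog_nonneg hx
  unfold mulLogMajorant
  positivity

/-- Substitution `t = log x`; the subtracted `1 / (x log x)` becomes `1 / t`. -/
theorem integral_mulLogPowDiff (w : ℂ) {b : ℝ} (hb : 2 ≤ b) :
    ∫ x in (2 : ℝ)..b, mulLogPowDiff w x =
      (∫ t in Real.log 2..Real.log b, (t : ℂ) ^ (-w - 1) * Complex.exp (-(w * t))) -
        (Real.log (Real.log b) - Real.log (Real.log 2) : ℝ) := by
  have hl2 : 0 < Real.log 2 := Real.log_pos (by norm_num)
  have hlb : Real.log 2 ≤ Real.log b := Real.log_le_log two_pos hb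
  have hcont : ∀ t : ℝ, 0 < t →
      ContinuousAt (fun t : ℝ => (t : ℂ) ^ (-w - 1) * Complex.exp (-(w * t))) t := by
    intro t ht
    have h1 : ContinuousAt (fun t : ℝ => (t : ℂ) ^ (-w - 1)) t :=
      Complex.continuousAt_ofReal_cpow_const _ _ (Or.inr ht.ne')
    exact h1.mul (by fun_prop)
  have hinv : ∀ t : ℝ, 0 < t → ContinuousAt (fun t : ℝ => ((t⁻¹ : ℝ) : ℂ)) t := fun t ht =>
    Complex.continuous_ofReal.continuousAt.comp (continuousAt_inv₀ ht.ne')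
  have hpos : ∀ t ∈ Set.uIcc (Real.log 2) (Real.log b), 0 < t := fun t ht => by
    rw [Set.uIcc_of_le hlb] at ht
    exact hl2.trans_le ht.1
  have hge : ∀ x ∈ Set.uIcc 2 b, 2 ≤ x := fun x hx => by
    rw [Set.uIcc_of_le hb] at hx
    exact hx.1
  have hsub := intervalIntegral.integral_deriv_smul_comp' (a := 2) (b := b) (f := Real.log)
    (f' := fun x => x⁻¹)
    (g := fun t : ℝ => (t : ℂ) ^ (-w - 1) * Complex.exp (-(w * t)) - ((t⁻¹ : ℝ) : ℂ))
    (fun x hx => Real.hasDerivAt_log (by linarith [hge x hx]))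
    (fun x hx => (continuousAt_inv₀ (by linarith [hge x hx])).continuousWithinAt)
    (by
      rintro t ⟨x, hx, rfl⟩
      have : 0 < Real.log x := Real.log_pos (by linarith [hge x hx])
      exact ((hcont _ this).sub (hinv _ this)).continuousWithinAt)
  rw [intervalIntegral.integral_sub
    (ContinuousOn.intervalIntegrable fun t ht => (hcont t (hpos t ht)).continuousWithinAt)
    (ContinuousOn.intervalIntegrable fun t ht => (hinv t (hpos t ht)).continuousWithinAt),
    intervalIntegral.integral_ofReal, integral_inv_of_pos hl2 (hl2.trans_le hlb),
    Real.log_div (hl2.trans_le hlb).ne' hl2.ne'] at hsub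
  rw [← hsub]
  refine intervalIntegral.integral_congr fun x hx => ?_
  have hx2 := hge x hx
  have hlx : 0 < Real.log x := Real.log_pos (by linarith)
  have e1 : Complex.exp (-logMulLog x) = ((x⁻¹ : ℝ) : ℂ) * (((Real.log x)⁻¹ : ℝ) : ℂ) := by
    rw [← Complex.ofReal_neg, ← Complex.ofReal_exp, Real.exp_neg,
      exp_logMulLog (by linarith), mul_inv, Complex.ofReal_mul]
  have e2 : (Real.log x : ℂ) ^ (-w - 1) = Complex.exp (-(w * Real.log (Real.log x))) *
      (((Real.log x)⁻¹ : ℝ) : ℂ) := by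
    have h0 : (Real.log x : ℂ) ≠ 0 := by exact_mod_cast hlx.ne'
    rw [Complex.cpow_sub _ _ h0, Complex.cpow_one, Complex.cpow_def_of_ne_zero h0,
      ← Complex.ofReal_log hlx.le, div_eq_mul_inv, Complex.ofReal_inv]
    ring_nf
  have e3 : Complex.exp (-(1 + w) * logMulLog x) = Complex.exp (-logMulLog x) *
      (Complex.exp (-(w * Real.log (Real.log x))) * Complex.exp (-(w * Real.log x))) := by
    rw [← Complex.exp_add, ← Complex.exp_add]
    congr 1
    simp only [logMulLog]
    push_cast
    ring
  simp only [Function.comp_apply, Complex.real_smul, mulLogPowDiff]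
  rw [e3, e2, e1]
  ring

/-! ### Existence of the constant -/

theorem exists_isLogLogConstant : ∃ C : ℝ, IsLogLogConstant C := by
  have step : ∀ n : ℕ, 2 ≤ n →
      1 / (((n + 1 : ℕ) : ℝ) * Real.log (n + 1 : ℕ)) ≤
        Real.log (Real.log (n + 1 : ℕ)) - Real.log (Real.log n) ∧
      Real.log (Real.log (n + 1 : ℕ)) - Real.log (Real.log n) ≤ 1 / ((n : ℝ) * Real.log n) := by
    intro n hn
    have hn' : (2 : ℝ) ≤ n := by exact_mod_cast hn
    have hn0 : (0 : ℝ) < n := by linarith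
    have ha : 0 < Real.log n := Real.log_pos (by linarith)
    have hb : 0 < Real.log (n + 1 : ℕ) := Real.log_pos (by push_cast; linarith)
    have hn1 : (0 : ℝ) < (n + 1 : ℕ) := by positivity
    -- Both bounds on the increment of `log log` come from `log y ≤ y - 1`, applied to ratios of
    -- consecutive integers and of their logarithms.
    have hbn := Real.log_le_sub_one_of_pos (div_pos hn1 hn0)
    have hnb := Real.log_le_sub_one_of_pos (div_pos hn0 hn1)
    have hLb := Real.log_le_sub_one_of_pos (div_pos hb ha)
    have hLa := Real.log_le_sub_one_of_pos (div_pos ha hb)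
    rw [Real.log_div hn1.ne' hn0.ne'] at hbn
    rw [Real.log_div hn0.ne' hn1.ne'] at hnb
    rw [Real.log_div hb.ne' ha.ne'] at hLb
    rw [Real.log_div ha.ne' hb.ne'] at hLa
    have d1 : Real.log (n + 1 : ℕ) - Real.log n ≤ 1 / n := by
      refine hbn.trans_eq ?_
      push_cast
      field_simp
      ring
    have d2 : 1 / ((n + 1 : ℕ) : ℝ) ≤ Real.log (n + 1 : ℕ) - Real.log n := by
      have : (n : ℝ) / (n + 1 : ℕ) - 1 = -(1 / ((n + 1 : ℕ) : ℝ)) := by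
        push_cast
        field_simp
        ring
      linarith
    constructor
    · have h1 : 1 / (((n + 1 : ℕ) : ℝ) * Real.log (n + 1 : ℕ)) ≤
          (Real.log (n + 1 : ℕ) - Real.log n) / Real.log (n + 1 : ℕ) := by
        rw [← div_div]
        gcongr
      have h2 : (Real.log (n + 1 : ℕ) - Real.log n) / Real.log (n + 1 : ℕ) =
          -(Real.log n / Real.log (n + 1 : ℕ) - 1) := by
        field_simp
        ring
      linarith
    · have h1 : (Real.log (n + 1 : ℕ) - Real.log n) / Real.log n ≤
          1 / ((n : ℝ) * Real.log n) := by
        rw [← div_div]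
        gcongr
      have h2 : (Real.log (n + 1 : ℕ) - Real.log n) / Real.log n =
          Real.log (n + 1 : ℕ) / Real.log n - 1 := by
        field_simp
      linarith
  set u : ℕ → ℝ := fun n => (∑ k ∈ Finset.Ico 2 n, 1 / ((k : ℝ) * Real.log k)) -
    Real.log (Real.log n) with hu
  have hmono : Monotone fun n => u (n + 2) := by
    refine monotone_nat_of_le_succ fun n => ?_
    have h := (step (n + 2) (by omega)).2
    have hsum := Finset.sum_Ico_succ_top (show 2 ≤ n + 2 by omega)
      fun k : ℕ => 1 / ((k : ℝ) * Real.log k)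
    simp only [hu]
    rw [show n + 1 + 2 = (n + 2) + 1 by omega, hsum]
    linarith
  -- Adding the next term of the sum makes the increasing sequence decreasing, which bounds it
  -- above.
  have hanti : Antitone fun n => u (n + 2) + 1 / (((n + 2 : ℕ) : ℝ) * Real.log (n + 2 : ℕ)) := by
    refine antitone_nat_of_succ_le fun n => ?_
    have h := (step (n + 2) (by omega)).1
    have hsum := Finset.sum_Ico_succ_top (show 2 ≤ n + 2 by omega)
      fun k : ℕ => 1 / ((k : ℝ) * Real.log k)
    simp only [hu]
    rw [show n + 1 + 2 = (n + 2) + 1 by omega, hsum]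
    linarith
  have hbdd : BddAbove (Set.range fun n => u (n + 2)) := by
    refine ⟨u 2 + 1 / (((0 + 2 : ℕ) : ℝ) * Real.log (0 + 2 : ℕ)), ?_⟩
    rintro _ ⟨n, rfl⟩
    refine le_trans ?_ (hanti (Nat.zero_le n))
    have : 0 ≤ 1 / (((n + 2 : ℕ) : ℝ) * Real.log (n + 2 : ℕ)) := by positivity
    simp only
    linarith
  exact ⟨_, (tendsto_add_atTop_iff_nat 2).mp (tendsto_atTop_ciSup hmono hbdd)⟩

/-! ### Summability and conclusion -/

theorem summable_mul_log_cpow_neg {s : ℂ} (hs : 1 < s.re) :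
    Summable (fun n : ℕ =>
      ((((n + 2 : ℕ) : ℝ) * Real.log ((n + 2 : ℕ) : ℝ) : ℝ) : ℂ) ^ (-s)) := by
  have hsum : Summable fun n : ℕ => ((n + 2 : ℕ) : ℝ) ^ (-s.re) * (Real.log 2) ^ (-s.re) :=
    ((summable_nat_add_iff 2).mpr
      (Real.summable_nat_rpow.mpr (show -s.re < -1 by linarith))).mul_right _
  refine hsum.of_norm_bounded fun n => ?_
  have hl2 : 0 < Real.log 2 := Real.log_pos (by norm_num)
  have hle : Real.log 2 ≤ Real.log ((n + 2 : ℕ) : ℝ) :=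
    Real.log_le_log two_pos (by push_cast; linarith [n.cast_nonneg (α := ℝ)])
  have hl : 0 < Real.log ((n + 2 : ℕ) : ℝ) := hl2.trans_le hle
  rw [Complex.norm_cpow_eq_rpow_re_of_pos (by positivity), Complex.neg_re,
    Real.mul_rpow (by positivity) hl.le]
  exact mul_le_mul_of_nonneg_left
    (Real.rpow_le_rpow_of_nonpos hl2 hle (by linarith)) (by positivity)

open MeasureTheory Set in
/-- Comparison of the series with the corresponding integral, uniformly in the half-plane. -/
theorem norm_nLogNZeta_sub_integral_le {C : ℝ} (hC : IsLogLogConstant C) {w : ℂ}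
    (hw : 0 < w.re) :
    ‖nLogNZeta (1 + w) - C - Real.log (Real.log 2) -
        ∫ t : ℝ in Ioi (Real.log 2), (t : ℂ) ^ (-w - 1) * Complex.exp (-(w * t))‖ ≤
      ‖w‖ * mulLogMajorant 2 := by
  have hl2 : 0 < Real.log 2 := Real.log_pos (by norm_num)
  have hsum : Tendsto (fun n : ℕ => ∑ k ∈ Finset.range n,
      ((((k + 2 : ℕ) : ℝ) * Real.log ((k + 2 : ℕ) : ℝ) : ℝ) : ℂ) ^ (-(1 + w))) atTop
      (𝓝 (nLogNZeta (1 + w))) :=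
    (summable_mul_log_cpow_neg (by simpa using hw)).hasSum.tendsto_sum_nat
  have hCt : Tendsto (fun n : ℕ => (((∑ k ∈ Finset.Ico 2 (n + 2), 1 / ((k : ℝ) * Real.log k)) -
      Real.log (Real.log ((n + 2 : ℕ) : ℝ)) : ℝ) : ℂ)) atTop (𝓝 C) :=
    (Complex.continuous_ofReal.tendsto C).comp ((tendsto_add_atTop_iff_nat 2).mpr hC)
  have hlog : Tendsto (fun n : ℕ => Real.log ((n + 2 : ℕ) : ℝ)) atTop atTop :=
    Real.tendsto_log_atTop.comp
      (tendsto_natCast_atTop_atTop.comp (tendsto_add_atTop_nat 2))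
  have hint := intervalIntegral_tendsto_integral_Ioi (Real.log 2)
    (integrableOn_cpow_sub_one_mul_exp_neg_mul hl2 hw) hlog
  -- The finite comparison passes to the limit: the divergent `log log n` is paired with the sum of
  -- `1 / (k log k)`, so every remaining piece converges.
  refine le_of_tendsto (((hsum.sub hCt).sub tendsto_const_nhds).sub hint).norm
    (Eventually.of_forall fun n => ?_)
  have hbound := norm_sum_mulLogPowDiff_sub_integral_le hw.le (show 2 ≤ n + 2 by omega)
  have hn2 : (2 : ℝ) ≤ (n + 2 : ℕ) := by push_cast; linarith [n.cast_nonneg (α := ℝ)]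
  have hfin : ∑ k ∈ Finset.Ico 2 (n + 2), mulLogPowDiff w k =
      (∑ k ∈ Finset.range n,
        ((((k + 2 : ℕ) : ℝ) * Real.log ((k + 2 : ℕ) : ℝ) : ℝ) : ℂ) ^ (-(1 + w))) -
      ((∑ k ∈ Finset.Ico 2 (n + 2), 1 / ((k : ℝ) * Real.log k) : ℝ) : ℂ) := by
    rw [Complex.ofReal_sum, Finset.sum_Ico_eq_sum_range, Finset.sum_Ico_eq_sum_range,
      Nat.add_sub_cancel, ← Finset.sum_sub_distrib]
    refine Finset.sum_congr rfl fun k _ => ?_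
    have hk : (1 : ℝ) < (k + 2 : ℕ) := by push_cast; linarith [k.cast_nonneg (α := ℝ)]
    rw [add_comm 2 k, mulLogPowDiff, ofReal_mul_log_cpow_neg hk, ← Complex.ofReal_neg,
      ← Complex.ofReal_exp, Real.exp_neg, exp_logMulLog hk, one_div]
  rw [hfin, integral_mulLogPowDiff w hn2] at hbound
  refine le_trans (le_of_eq ?_) (hbound.trans ?_)
  · congr 1
    push_cast
    ring
  · exact mul_le_mul_of_nonneg_left (by linarith [mulLogMajorant_nonneg hn2]) (norm_nonneg w)

theorem nLogNZeta_one_add_isBigO {C : ℝ} (hC : IsLogLogConstant C) :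
    (fun w : ℂ => nLogNZeta (1 + w) -
        (-Complex.log w + (C : ℂ) - (Real.eulerMascheroniConstant : ℂ)))
      =O[𝓝[{w : ℂ | 0 < w.re}] 0] (fun w => w * Complex.log w ^ 2) := by
  have hne : 𝓝[{w : ℂ | 0 < w.re}] (0 : ℂ) ≤ 𝓝[≠] 0 :=
    nhdsWithin_mono _ fun w hw h => by
      rw [Set.mem_singleton_iff.mp h] at hw
      simp at hw
  have hw : (fun w : ℂ => w) =O[𝓝[{w : ℂ | 0 < w.re}] 0] (fun w => w * Complex.log w ^ 2) := by
    simpa using (isBigO_refl (fun w : ℂ => w) _).mul ((one_isBigO_clog.pow 2).mono hne)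
  have h1 : (fun w : ℂ => nLogNZeta (1 + w) - C - Real.log (Real.log 2) -
      ∫ t : ℝ in Set.Ioi (Real.log 2), (t : ℂ) ^ (-w - 1) * Complex.exp (-(w * t)))
      =O[𝓝[{w : ℂ | 0 < w.re}] 0] (fun w => w) := by
    refine IsBigO.of_bound (mulLogMajorant 2) ?_
    filter_upwards [self_mem_nhdsWithin] with w hw
    rw [mul_comm]
    exact norm_nLogNZeta_sub_integral_le hC hw
  have h2 := integral_cpow_sub_one_mul_exp_neg_mul_isBigO (Real.log_pos one_lt_two)
  exact ((h1.trans hw).add h2).congr_left fun w => by ring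

theorem mainTheorem8 :
    (∀ s : ℂ, 1 < s.re →
      Summable (fun n : ℕ =>
        ((((n + 2 : ℕ) : ℝ) * Real.log ((n + 2 : ℕ) : ℝ) : ℝ) : ℂ) ^ (-s))) ∧
    ∃ C : ℝ, IsLogLogConstant C ∧
      (fun s : ℂ => nLogNZeta s -
          (-Complex.log (s - 1) + (C : ℂ) - (Real.eulerMascheroniConstant : ℂ)))
        =O[𝓝[{s : ℂ | 1 < s.re}] 1]
      (fun s : ℂ => (s - 1) * Complex.log (s - 1) ^ 2) := by
  refine ⟨fun s hs => summable_mul_log_cpow_neg hs, ?_⟩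
  obtain ⟨C, hC⟩ := exists_isLogLogConstant
  refine ⟨C, hC, ?_⟩
  have ht : Tendsto (fun s : ℂ => s - 1) (𝓝[{s : ℂ | 1 < s.re}] 1)
      (𝓝[{w : ℂ | 0 < w.re}] 0) := by
    refine tendsto_nhdsWithin_of_tendsto_nhds_of_eventually_within _ ?_ ?_
    · have hc : Continuous (fun s : ℂ => s - 1) := by fun_prop
      simpa using (hc.tendsto 1).mono_left nhdsWithin_le_nhds
    · filter_upwards [self_mem_nhdsWithin] with s hs
      simpa using hs
  refine ((nLogNZeta_one_add_isBigO hC).comp_tendsto ht).congr (fun s => ?_) fun s => rfl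
  simp
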